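/- Let $d\ge 1$ be an integer and $0<\alpha<d$. A *cube* is a set $Q=[x_1,x_1+l[\,\times\dots\times[x_d,x_d+l[\,\subseteq\mathbb{R}^d$ with $l>0$. For $0<\eta<1$, a collection $\mathcal S$ of measurable subsets of $\mathbb{R}^d$ is *$\eta$-sparse* if for each $Q\in\mathcal S$ there is a measurable set $G(Q)\subseteq Q$ with $|G(Q)|\ge\eta|Q|$ such that the sets $G(Q)$, $Q\in\mathcal S$, are pairwise disjoint. The Riesz potential of $f$ is $$\mathcal I_\alpha f(x)=\int_{\mathbb{R}^d}\frac{f(x-y)}{|y|^{d-\alpha}}\,dy .$$ There is a constant $C<\infty$, depending only on $d$ and $\alpha$, such that the following holds. For every (complex-valued) $f\in L^1(\mathbb{R}^d)$ with compact support, the integral defining $\mathcal I_\alpha f(x)$ converges absolutely for a.e. $x\in\mathbb{R}^d$, and there is a $\frac{1}{2(4\sqrt d+2)^d}$-sparse family $\mathcal S=\mathcal S(f)$ of cubes such that $$|\mathcal I_\alpha f(x)|\le C\sum_{Q\in\mathcal S}\chi_Q(x)\,|Q|^{\alpha/d}\,\frac{1}{|Q|}\int_Q|f|\qquad\text{for a.e.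 }x\in\mathbb{R}^d .$$ -/

import Mathlib

open MeasureTheory
open scoped ENNReal NNReal

noncomputable section

namespace SparseRiesz

/-- The half-open axis-parallel cube `[x₁, x₁ + l[ × ⋯ × [x_d, x_d + l[` with corner `x` and
sidelength `l`. -/
def cube {d : ℕ} (x : EuclideanSpace ℝ (Fin d)) (l : ℝ) : Set (EuclideanSpace ℝ (Fin d)) :=
  {y | ∀ i, x i ≤ y i ∧ y i < x i + l}

/-- `Q` is a half-open axis-parallel cube with positive sidelength. -/
def IsCube {d : ℕ} (Q : Set (EuclideanSpace ℝ (Fin d))) : Prop :=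
  ∃ (x : EuclideanSpace ℝ (Fin d)) (l : ℝ), 0 < l ∧ Q = cube x l

/-- A collection `S` of measurable sets is `η`-sparse if every `Q ∈ S` has a measurable subset
`G Q` with `|G Q| ≥ η |Q|` such that the sets `G Q`, `Q ∈ S`, are pairwise disjoint. -/
def IsSparse {d : ℕ} (η : ℝ) (S : Set (Set (EuclideanSpace ℝ (Fin d)))) : Prop :=
  (∀ Q ∈ S, MeasurableSet Q) ∧
  ∃ G : Set (EuclideanSpace ℝ (Fin d)) → Set (EuclideanSpace ℝ (Fin d)),
    (∀ Q ∈ S, MeasurableSet (G Q) ∧ G Q ⊆ Q ∧ ENNReal.ofReal η * volume Q ≤ volume (G Q)) ∧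
    S.PairwiseDisjoint G

/-- The function `f`, thought of as a class modulo null sets, has compact support: it vanishes
almost everywhere outside some compact set. -/
def HasCompactEssSupport {d : ℕ} (f : EuclideanSpace ℝ (Fin d) → ℂ) : Prop :=
  ∃ K : Set (EuclideanSpace ℝ (Fin d)), IsCompact K ∧ ∀ᵐ x, x ∉ K → f x = 0

/-- The integrand `y ↦ |y|^{-(d-α)} f(x - y)` of the Riesz potential at the point `x`. -/
def rieszIntegrand {d : ℕ} (α : ℝ) (f : EuclideanSpace ℝ (Fin d) → ℂ)
    (x y : EuclideanSpace ℝ (Fin d)) : ℂ :=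
  (1 / ‖y‖ ^ ((d : ℝ) - α)) • f (x - y)

/-- The Riesz potential `I_α f(x) = ∫ |y|^{-(d-α)} f(x - y) dy`. -/
def rieszPotential {d : ℕ} (α : ℝ) (f : EuclideanSpace ℝ (Fin d) → ℂ)
    (x : EuclideanSpace ℝ (Fin d)) : ℂ :=
  ∫ y, rieszIntegrand α f x y

/-- The sparse operator `∑_{Q ∈ S} χ_Q(x) |Q|^{α/d} ⨍_Q |f|`, a sum of non-negative terms with
value in `[0, ∞]`. -/
def sparseOperator {d : ℕ} (α : ℝ) (S : Set (Set (EuclideanSpace ℝ (Fin d))))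
    (f : EuclideanSpace ℝ (Fin d) → ℂ) (x : EuclideanSpace ℝ (Fin d)) : ℝ≥0∞ :=
  ∑' Q : S, (Q : Set (EuclideanSpace ℝ (Fin d))).indicator
    (fun _ => volume (Q : Set (EuclideanSpace ℝ (Fin d))) ^ (α / d) *
      ((volume (Q : Set (EuclideanSpace ℝ (Fin d))))⁻¹ *
        ∫⁻ y in (Q : Set (EuclideanSpace ℝ (Fin d))), ‖f y‖ₑ)) x

end SparseRiesz

end

noncomputable section

namespace SparseRiesz

variable {d : ℕ}

/-! Cutting the kernel at dyadic radii bounds `I_α |f| (x)` by a multiple of `∑ₙ 2^(nα) avg n`,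
where `avg n` averages `|f|` over the triple of the generation-`n` dyadic cube containing `x`
(`lintegral_rieszIntegrand_le`). For each `k`, stop at the maximal dyadic cubes whose triple has
average above `A ^ k`; they exist because `f` is integrable, so averages vanish at large scales.
Every nonzero `avg n` is at most `A` times the average at some stopping generation `N ≥ n`, so the
sum over `n ≤ N` is geometric and only stopping cubes remain (`tsum_avg_le`). Sparseness: maximality
bounds the average on a level-`k` stopping cube by `2^d A^k`, so by the weak type estimate cubes of
average above `A^(k+1)` fill at most half of it (`volume_inter_superlevel_le`). The leftover halves
are disjoint. -/

lemma cube_eq_preimage (x : EuclideanSpace ℝ (Fin d)) (l : ℝ) :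
    cube x l = WithLp.ofLp ⁻¹' Set.univ.pi fun i => Set.Ico (x i) (x i + l) := by
  ext y
  simp [cube]

lemma measurableSet_cube (x : EuclideanSpace ℝ (Fin d)) (l : ℝ) : MeasurableSet (cube x l) := by
  rw [cube_eq_preimage]
  exact (PiLp.volume_preserving_ofLp (Fin d)).measurable
    (MeasurableSet.univ_pi fun _ => measurableSet_Ico)

lemma volume_cube (x : EuclideanSpace ℝ (Fin d)) (l : ℝ) :
    volume (cube x l) = ENNReal.ofReal l ^ d := by
  rw [cube_eq_preimage, (PiLp.volume_preserving_ofLp (Fin d)).measure_preimage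
    (MeasurableSet.univ_pi fun _ => measurableSet_Ico).nullMeasurableSet, Real.volume_pi_Ico]
  simp

/-- The cube with sidelength `(2 * r + 1) * 2 ^ n` concentric with the dyadic cube of generation `n`
and index `m`. -/
def dilate (r : ℝ) (n : ℤ) (m : Fin d → ℤ) : Set (EuclideanSpace ℝ (Fin d)) :=
  cube (WithLp.toLp 2 fun i => ((m i : ℝ) - r) * 2 ^ n) ((2 * r + 1) * 2 ^ n)

lemma mem_dilate {r : ℝ} {n : ℤ} {m : Fin d → ℤ} {y : EuclideanSpace ℝ (Fin d)} :
    y ∈ dilate r n m ↔ ∀ i, ((m i : ℝ) - r) * 2 ^ n ≤ y i ∧ y i < ((m i : ℝ) + r + 1) * 2 ^ n := by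
  refine forall_congr' fun i => and_congr Iff.rfl ?_
  rw [show ((m i : ℝ) + r + 1) * 2 ^ n = (m i - r) * 2 ^ n + (2 * r + 1) * 2 ^ n by ring]

lemma measurableSet_dilate (r : ℝ) (n : ℤ) (m : Fin d → ℤ) : MeasurableSet (dilate r n m) :=
  measurableSet_cube _ _

lemma volume_dilate (r : ℝ) (n : ℤ) (m : Fin d → ℤ) :
    volume (dilate r n m) = ENNReal.ofReal ((2 * r + 1) * 2 ^ n) ^ d :=
  volume_cube _ _

lemma volume_dilate_eq (k : ℕ) (n : ℤ) (m : Fin d → ℤ) :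
    volume (dilate k n m) = (2 * k + 1 : ℕ) ^ d * volume (dilate 0 n m) := by
  rw [volume_dilate, volume_dilate, ENNReal.ofReal_mul (by positivity), mul_pow]
  congr 2
  · rw [← ENNReal.ofReal_natCast]; norm_num
  · norm_num

lemma volume_dilate_ne_zero {r : ℝ} (hr : 0 ≤ r) (n : ℤ) (m : Fin d → ℤ) :
    volume (dilate r n m) ≠ 0 := by
  rw [volume_dilate]
  exact pow_ne_zero _ (ENNReal.ofReal_pos.2 (by positivity)).ne'

lemma volume_dilate_ne_top (r : ℝ) (n : ℤ) (m : Fin d → ℤ) : volume (dilate r n m) ≠ ∞ := by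
  rw [volume_dilate]
  exact ENNReal.pow_ne_top ENNReal.ofReal_ne_top

/-- The index of the dyadic cube of generation `n` containing `x`. -/
def idx (n : ℤ) (x : EuclideanSpace ℝ (Fin d)) : Fin d → ℤ := fun i => ⌊x i / 2 ^ n⌋

lemma idx_eq_iff {n : ℤ} {m : Fin d → ℤ} {y : EuclideanSpace ℝ (Fin d)} :
    idx n y = m ↔ y ∈ dilate 0 n m := by
  have h2 : (0 : ℝ) < 2 ^ n := by positivity
  simp only [funext_iff, idx, mem_dilate, Int.floor_eq_iff, le_div_iff₀ h2, div_lt_iff₀ h2]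
  simp

lemma mem_dilate_idx (n : ℤ) (x : EuclideanSpace ℝ (Fin d)) : x ∈ dilate 0 n (idx n x) :=
  idx_eq_iff.1 rfl

lemma dilate_mono {r s : ℝ} (h : r ≤ s) (n : ℤ) (m : Fin d → ℤ) : dilate r n m ⊆ dilate s n m := by
  intro y hy
  rw [mem_dilate] at hy ⊢
  have h2 : (0 : ℝ) < 2 ^ n := by positivity
  intro i
  refine ⟨le_trans ?_ (hy i).1, (hy i).2.trans_le ?_⟩ <;> gcongr

lemma measurable_idx (n : ℤ) : Measurable (idx (d := d) n) := by
  refine measurable_pi_lambda _ fun i => Int.measurable_floor.comp ?_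
  fun_prop

lemma idx_succ (n : ℤ) (x : EuclideanSpace ℝ (Fin d)) : idx (n + 1) x = fun i => idx n x i / 2 := by
  ext i
  have h : x i / 2 ^ (n + 1) = x i / 2 ^ n / (2 : ℕ) := by
    rw [zpow_add_one₀ two_ne_zero, div_div]; norm_num
  simp only [idx, h, Int.floor_div_natCast]
  norm_num

lemma idx_eq_of_le {n N : ℤ} (h : n ≤ N) {x y : EuclideanSpace ℝ (Fin d)} (hxy : idx n x = idx n y) :
    idx N x = idx N y := by
  induction N, h using Int.leInduction with
  | base => exact hxy
  | succ N _ ih => rw [idx_succ, idx_succ, ih]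

lemma dilate_one_subset_succ (n : ℤ) (x : EuclideanSpace ℝ (Fin d)) :
    dilate 1 n (idx n x) ⊆ dilate 1 (n + 1) (idx (n + 1) x) := by
  intro y hy
  rw [mem_dilate] at hy ⊢
  intro i
  have h2 : (0 : ℝ) < 2 ^ n := by positivity
  obtain ⟨h3, h4⟩ := hy i
  have h5 : 2 * idx (n + 1) x i ≤ idx n x i := by rw [idx_succ]; dsimp only; omega
  have h6 : idx n x i ≤ 2 * idx (n + 1) x i + 1 := by rw [idx_succ]; dsimp only; omega
  have h5' : 2 * (idx (n + 1) x i : ℝ) ≤ idx n x i := by exact_mod_cast h5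
  have h6' : (idx n x i : ℝ) ≤ 2 * idx (n + 1) x i + 1 := by exact_mod_cast h6
  rw [zpow_add_one₀ two_ne_zero]
  constructor <;> nlinarith

lemma dilate_one_subset {n N : ℤ} (h : n ≤ N) (x : EuclideanSpace ℝ (Fin d)) :
    dilate 1 n (idx n x) ⊆ dilate 1 N (idx N x) := by
  induction N, h using Int.leInduction with
  | base => exact subset_rfl
  | succ N _ ih => exact ih.trans (dilate_one_subset_succ N x)

/-! ### Averages over triples and stopping cubes. -/

/-- The average of `g` over the threefold dilate of a dyadic cube. -/
def avg (g : EuclideanSpace ℝ (Fin d) → ℝ≥0∞) (n : ℤ) (m : Fin d → ℤ) : ℝ≥0∞ :=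
  (volume (dilate 1 n m))⁻¹ * ∫⁻ y in dilate 1 n m, g y

variable {g : EuclideanSpace ℝ (Fin d) → ℝ≥0∞}

lemma lintegral_eq_avg (n : ℤ) (m : Fin d → ℤ) :
    ∫⁻ y in dilate 1 n m, g y = volume (dilate 1 n m) * avg g n m := by
  rw [avg, ← mul_assoc, ENNReal.mul_inv_cancel (volume_dilate_ne_zero zero_le_one _ _)
    (volume_dilate_ne_top _ _ _), one_mul]

lemma avg_ne_top (hg : ∫⁻ y, g y ≠ ∞) (n : ℤ) (m : Fin d → ℤ) : avg g n m ≠ ∞ :=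
  ENNReal.mul_ne_top (ENNReal.inv_ne_top.2 (volume_dilate_ne_zero zero_le_one _ _))
    (ne_top_of_le_ne_top hg (setLIntegral_le_lintegral _ _))

lemma avg_le_succ (n : ℤ) (x : EuclideanSpace ℝ (Fin d)) :
    avg g n (idx n x) ≤ 2 ^ d * avg g (n + 1) (idx (n + 1) x) := by
  have hv : volume (dilate 1 (n + 1) (idx (n + 1) x)) = 2 ^ d * volume (dilate 1 n (idx n x)) := by
    rw [volume_dilate, volume_dilate, zpow_add_one₀ two_ne_zero, ← mul_assoc,
      ENNReal.ofReal_mul (by positivity), mul_pow, mul_comm]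
    norm_num
  have h2 : (2 ^ d : ℝ≥0∞) ≠ 0 := by positivity
  have h2' : (2 ^ d : ℝ≥0∞) ≠ ∞ := by simp
  rw [avg, avg, hv, ENNReal.mul_inv (.inl h2) (.inl h2'), ← mul_assoc, ← mul_assoc,
    ENNReal.mul_inv_cancel h2 h2', one_mul]
  gcongr
  exact dilate_one_subset_succ n x

/-- The averages over large cubes are small. -/
lemma exists_avg_le (hd : d ≠ 0) (hg : ∫⁻ y, g y ≠ ∞) {c : ℝ≥0∞} (hc : c ≠ 0) :
    ∃ N₀ : ℤ, ∀ n, N₀ ≤ n → ∀ m, avg g n m ≤ c := by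
  by_cases hct : c = ∞
  · exact ⟨0, fun n _ m => hct ▸ le_top⟩
  obtain ⟨N, hN⟩ := ENNReal.exists_nat_gt (r := (∫⁻ y, g y) / c)
    (ENNReal.div_ne_top hg hc)
  refine ⟨N, fun n hn m => ?_⟩
  have hv : (N : ℝ≥0∞) ≤ volume (dilate 1 n m) := by
    have h1 : (1 : ℝ) ≤ 2 ^ n := one_le_zpow₀ one_le_two (by omega)
    have h2 : (N : ℝ) ≤ 2 ^ n := by
      calc (N : ℝ) ≤ 2 ^ N := by exact_mod_cast Nat.lt_two_pow_self.le
        _ = 2 ^ (N : ℤ) := by simp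
        _ ≤ 2 ^ n := zpow_le_zpow_right₀ one_le_two hn
    rw [volume_dilate, ← ENNReal.ofReal_pow (by positivity), ← ENNReal.ofReal_natCast]
    refine ENNReal.ofReal_le_ofReal ?_
    calc (N : ℝ) ≤ (2 * 1 + 1) * 2 ^ n := by linarith
      _ ≤ _ := le_self_pow₀ (by linarith) hd
  rw [avg, mul_comm, ← div_eq_mul_inv]
  refine ENNReal.div_le_of_le_mul ?_
  calc ∫⁻ y in dilate 1 n m, g y ≤ ∫⁻ y, g y := setLIntegral_le_lintegral _ _
    _ ≤ N * c := (ENNReal.div_le_iff hc hct).1 hN.le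
    _ ≤ volume (dilate 1 n m) * c := by gcongr
    _ = _ := mul_comm _ _

/-- The dyadic cube of generation `n` containing `x` is maximal among the dyadic cubes on whose
threefold dilate the average of `g` exceeds `A ^ k`. -/
def IsStopping (g : EuclideanSpace ℝ (Fin d) → ℝ≥0∞) (A : ℝ≥0∞) (n : ℤ)
    (x : EuclideanSpace ℝ (Fin d)) (k : ℤ) : Prop :=
  A ^ k < avg g n (idx n x) ∧ ∀ N, n < N → avg g N (idx N x) ≤ A ^ k

variable {A : ℝ≥0∞}

lemma IsStopping.congr {n : ℤ} {x y : EuclideanSpace ℝ (Fin d)} {k : ℤ} (h : IsStopping g A n x k)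
    (hxy : idx n y = idx n x) : IsStopping g A n y k := by
  refine ⟨hxy ▸ h.1, fun N hN => ?_⟩
  rw [idx_eq_of_le hN.le hxy]
  exact h.2 N hN

lemma IsStopping.avg_le {n : ℤ} {x : EuclideanSpace ℝ (Fin d)} {k : ℤ} (h : IsStopping g A n x k) :
    avg g n (idx n x) ≤ 2 ^ d * A ^ k :=
  (avg_le_succ n x).trans (by gcongr; exact h.2 _ (lt_add_one n))

lemma exists_isStopping (hd : d ≠ 0) (hg : ∫⁻ y, g y ≠ ∞) (hA : 1 < A) (hA' : A ≠ ∞) (n : ℤ)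
    (x : EuclideanSpace ℝ (Fin d)) (h : avg g n (idx n x) ≠ 0) :
    ∃ N k, n ≤ N ∧ IsStopping g A N x k ∧ avg g n (idx n x) ≤ A * avg g N (idx N x) := by
  -- Choose `k` with `A^k < avg ≤ A^(k+1)`, then climb to the last generation still above `A^k`.
  obtain ⟨k, hk, hk'⟩ := ENNReal.exists_mem_Ioc_zpow h (avg_ne_top hg _ _) hA hA'
  have hA0 : A ≠ 0 := (zero_lt_one.trans hA).ne'
  obtain ⟨N₀, hN₀⟩ := exists_avg_le hd hg (c := A ^ k) (ENNReal.zpow_pos hA0 hA' k).ne'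
  obtain ⟨N, hN, hmax⟩ := Int.exists_greatest_of_bdd
    (P := fun N => A ^ k < avg g N (idx N x))
    ⟨N₀, fun z hz => by_contra fun hlt => (hN₀ z (by omega) (idx z x)).not_gt hz⟩ ⟨n, hk⟩
  refine ⟨N, k, hmax n hk, ⟨hN, fun M hM => ?_⟩, hk'.trans ?_⟩
  · by_contra hlt
    exact absurd (hmax M (not_le.1 hlt)) (by omega)
  · rw [ENNReal.zpow_add hA0 hA', zpow_one, mul_comm]
    gcongr

/-- The set of points lying in a dyadic cube on whose threefold dilate the average exceeds `c`. -/
def superlevel (g : EuclideanSpace ℝ (Fin d) → ℝ≥0∞) (c : ℝ≥0∞) : Set (EuclideanSpace ℝ (Fin d)) :=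
  {x | ∃ n, c < avg g n (idx n x)}

lemma measurableSet_superlevel (c : ℝ≥0∞) : MeasurableSet (superlevel g c) := by
  have : superlevel g c = ⋃ n : ℤ, idx n ⁻¹' {m | c < avg g n m} := by
    ext x; simp [superlevel]
  rw [this]
  exact .iUnion fun n => measurable_idx n (Set.to_countable _).measurableSet

/-! ### Weak type bound and sparseness. -/

/-- A dyadic weak type `(1, 1)` estimate. -/
lemma volume_iUnion_dilate_le {c : ℝ≥0∞} (hc : c ≠ 0) (T : Set (ℤ × (Fin d → ℤ))) (R : ℤ)
    (hR : ∀ a ∈ T, a.1 ≤ R) (F : Set (EuclideanSpace ℝ (Fin d)))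
    (hF : ∀ a ∈ T, dilate 1 a.1 a.2 ⊆ F) (hT : ∀ a ∈ T, c < avg g a.1 a.2) :
    volume (⋃ a ∈ T, dilate 0 a.1 a.2) ≤ 5 ^ d * (c⁻¹ * ∫⁻ y in F, g y) := by
  obtain ⟨u, huT, hdisj, hu⟩ := Vitali.exists_disjoint_subfamily_covering_enlargement
    (fun a : ℤ × (Fin d → ℤ) => dilate 1 a.1 a.2) T (fun a => (2 : ℝ) ^ a.1) 2 one_lt_two
    (fun a _ => by positivity) (2 ^ R) (fun a ha => zpow_le_zpow_right₀ one_le_two (hR a ha))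
    (fun a _ => nonempty_of_measure_ne_zero (volume_dilate_ne_zero zero_le_one _ _))
  -- The Vitali cube `b` has `2^a.1 ≤ 2 * 2^b.1` and its triple meets that of `a`, of side `3 *
  -- 2^a.1`; hence `7 = 1 + 3 * 2`, and side `15` is `5` times that of the triple.
  have hsub : (⋃ a ∈ T, dilate 0 a.1 a.2) ⊆ ⋃ b ∈ u, dilate (7 : ℕ) b.1 b.2 := by
    intro y hy
    obtain ⟨a, ha, hya⟩ := Set.mem_iUnion₂.1 hy
    obtain ⟨b, hb, ⟨z, hza, hzb⟩, hab⟩ := hu a ha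
    refine Set.mem_iUnion₂.2 ⟨b, hb, ?_⟩
    have hya' := dilate_mono zero_le_one _ _ hya
    rw [mem_dilate] at hza hzb hya' ⊢
    intro i
    obtain ⟨h1, h2⟩ := hya' i
    obtain ⟨h3, h4⟩ := hza i
    obtain ⟨h5, h6⟩ := hzb i
    push_cast
    constructor <;> linarith
  have hvol (b : ℤ × (Fin d → ℤ)) :
      volume (dilate (7 : ℕ) b.1 b.2) = 5 ^ d * volume (dilate 1 b.1 b.2) := by
    have h1 := volume_dilate_eq 1 b.1 b.2
    rw [Nat.cast_one] at h1
    rw [volume_dilate_eq, h1, ← mul_assoc, ← mul_pow]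
    norm_num
  have hcu : u.Countable := Set.to_countable u
  have hct (b) (hb : b ∈ u) : volume (dilate 1 b.1 b.2) ≤ c⁻¹ * ∫⁻ y in dilate 1 b.1 b.2, g y := by
    rw [lintegral_eq_avg, mul_comm, mul_assoc]
    have h1 : 1 ≤ avg g b.1 b.2 * c⁻¹ := by
      rw [← div_eq_mul_inv]
      exact (ENNReal.le_div_iff_mul_le (.inl hc) (.inl (hT b (huT hb)).ne_top)).2
        (by simpa using (hT b (huT hb)).le)
    exact le_mul_of_one_le_right' h1
  calc volume (⋃ a ∈ T, dilate 0 a.1 a.2) ≤ volume (⋃ b ∈ u, dilate (7 : ℕ) b.1 b.2) :=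
        measure_mono hsub
    _ ≤ ∑' b : u, volume (dilate (7 : ℕ) b.1.1 b.1.2) := measure_biUnion_le _ hcu _
    _ ≤ ∑' b : u, 5 ^ d * (c⁻¹ * ∫⁻ y in dilate 1 b.1.1 b.1.2, g y) := by
        refine ENNReal.tsum_le_tsum fun b => ?_
        rw [hvol]
        gcongr
        exact hct b b.2
    _ = 5 ^ d * (c⁻¹ * ∫⁻ y in ⋃ b ∈ u, dilate 1 b.1 b.2, g y) := by
        rw [ENNReal.tsum_mul_left, ENNReal.tsum_mul_left,
          lintegral_biUnion hcu (fun b _ => measurableSet_dilate _ _ _) hdisj]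
    _ ≤ _ := by
        gcongr
        exact Set.iUnion₂_subset fun b hb => hF b (huT hb)

/-- The factor `30 = 5 * 3 * 2` collects the weak type constant, the tripling and the passage to the
parent; the extra `2` in `A` leaves one half. Larger dyadic cubes do not contribute, by maximality.
-/
lemma volume_inter_superlevel_le (hA : 2 * 30 ^ d ≤ A) (hA' : A ≠ ∞) {n k : ℤ}
    {x : EuclideanSpace ℝ (Fin d)} (h : IsStopping g A n x k) :
    volume (dilate 0 n (idx n x) ∩ superlevel g (A ^ (k + 1))) ≤
      2⁻¹ * volume (dilate 0 n (idx n x)) := by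
  have h2A : 2 ^ d ≤ A := by
    refine le_trans ?_ hA
    calc (2 : ℝ≥0∞) ^ d ≤ 30 ^ d := by gcongr; norm_num
      _ ≤ 2 * 30 ^ d := le_mul_of_one_le_left' one_le_two
  have hA0 : A ≠ 0 := ((by positivity : (0 : ℝ≥0∞) < 2 ^ d).trans_le h2A).ne'
  have hk : A ^ (k + 1) = A * A ^ k := by rw [ENNReal.zpow_add hA0 hA', zpow_one, mul_comm]
  have hAk : A ^ k ≠ 0 := (ENNReal.zpow_pos hA0 hA' k).ne'
  have hAk' : A ^ k ≠ ∞ := (ENNReal.zpow_lt_top hA0 hA' k).ne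
  have havg := h.avg_le
  set Q := idx n x with hQ
  let T : Set (ℤ × (Fin d → ℤ)) :=
    {a | a.1 ≤ n ∧ dilate 1 a.1 a.2 ⊆ dilate 1 n Q ∧ A ^ (k + 1) < avg g a.1 a.2}
  have hsub : dilate 0 n Q ∩ superlevel g (A ^ (k + 1)) ⊆ ⋃ a ∈ T, dilate 0 a.1 a.2 := by
    rintro y ⟨hy, N, hN⟩
    have hyQ : idx n y = Q := idx_eq_iff.2 hy
    have hNn : N ≤ n := by
      by_contra hlt
      refine (lt_irrefl _) (hN.trans_le ((h.congr hyQ).2 N (not_le.1 hlt) |>.trans ?_))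
      rw [hk]
      exact le_mul_of_one_le_left' ((one_le_pow₀ one_le_two).trans h2A)
    refine Set.mem_iUnion₂.2 ⟨(N, idx N y), ⟨hNn, ?_, hN⟩, mem_dilate_idx N y⟩
    rw [← hyQ]
    exact dilate_one_subset hNn y
  calc volume (dilate 0 n Q ∩ superlevel g (A ^ (k + 1)))
      ≤ volume (⋃ a ∈ T, dilate 0 a.1 a.2) := measure_mono hsub
    _ ≤ 5 ^ d * ((A ^ (k + 1))⁻¹ * ∫⁻ y in dilate 1 n Q, g y) :=
        volume_iUnion_dilate_le (ENNReal.zpow_pos hA0 hA' _).ne' T n (fun a ha => ha.1) _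
          (fun a ha => ha.2.1) (fun a ha => ha.2.2)
    _ ≤ 5 ^ d * ((A ^ (k + 1))⁻¹ * (volume (dilate 1 n Q) * (2 ^ d * A ^ k))) := by
        rw [lintegral_eq_avg]; gcongr
    _ = A⁻¹ * 30 ^ d * volume (dilate 0 n Q) * (A ^ k * (A ^ k)⁻¹) := by
        have h1 := volume_dilate_eq 1 n Q
        rw [Nat.cast_one] at h1
        rw [hk, ENNReal.mul_inv (.inl hA0) (.inl hA'), h1,
          show (30 : ℝ≥0∞) = 5 * 3 * 2 by norm_num, mul_pow, mul_pow]
        push_cast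
        ring
    _ = A⁻¹ * 30 ^ d * volume (dilate 0 n Q) := by rw [ENNReal.mul_inv_cancel hAk hAk', mul_one]
    _ ≤ _ := by
        gcongr
        rw [mul_comm, ← div_eq_mul_inv]
        refine ENNReal.div_le_of_le_mul ?_
        calc (30 : ℝ≥0∞) ^ d = 2⁻¹ * (2 * 30 ^ d) := by
              rw [← mul_assoc, ENNReal.inv_mul_cancel two_ne_zero ENNReal.ofNat_ne_top, one_mul]
          _ ≤ _ := by gcongr

/-- The family of threefold dilates of stopping cubes. -/
def stoppingFamily (g : EuclideanSpace ℝ (Fin d) → ℝ≥0∞) (A : ℝ≥0∞) :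
    Set (Set (EuclideanSpace ℝ (Fin d))) :=
  {Q | ∃ n x k, IsStopping g A n x k ∧ Q = dilate 1 n (idx n x)}

lemma isCube_of_mem_stoppingFamily {Q : Set (EuclideanSpace ℝ (Fin d))}
    (hQ : Q ∈ stoppingFamily g A) : IsCube Q := by
  obtain ⟨n, x, -, -, rfl⟩ := hQ
  exact ⟨_, _, by positivity, rfl⟩

lemma isSparse_stoppingFamily (hA : 2 * 30 ^ d ≤ A) (hA' : A ≠ ∞) :
    IsSparse (1 / (2 * 3 ^ d)) (stoppingFamily g A) := by
  classical
  have hA1 : 1 ≤ A := le_trans (by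
    calc (1 : ℝ≥0∞) ≤ 30 ^ d := one_le_pow₀ (by norm_num)
      _ ≤ 2 * 30 ^ d := le_mul_of_one_le_left' one_le_two) hA
  refine ⟨fun Q ⟨n, x, _, _, hQ⟩ => hQ ▸ measurableSet_dilate _ _ _, ?_⟩
  -- A cube may stop at several levels; any one choice works.
  choose! n x k hsel hQ using
    fun (Q : Set (EuclideanSpace ℝ (Fin d))) (hQ : Q ∈ stoppingFamily g A) => hQ
  refine ⟨fun Q => dilate 0 (n Q) (idx (n Q) (x Q)) \ superlevel g (A ^ (k Q + 1)),
    fun Q hQS => ⟨(measurableSet_dilate _ _ _).diff (measurableSet_superlevel _), ?_, ?_⟩, ?_⟩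
  · conv_rhs => rw [hQ Q hQS]
    exact Set.sdiff_subset.trans (dilate_mono zero_le_one _ _)
  · have h1 := volume_inter_superlevel_le hA hA' (hsel Q hQS)
    have h2 := volume_dilate_eq 1 (n Q) (idx (n Q) (x Q))
    rw [Nat.cast_one, ← hQ Q hQS] at h2
    have h3 := measure_inter_add_sdiff (μ := volume) (dilate 0 (n Q) (idx (n Q) (x Q)))
      (measurableSet_superlevel (g := g) (A ^ (k Q + 1)))
    set V := volume (dilate 0 (n Q) (idx (n Q) (x Q))) with hV
    have hVt : V ≠ ∞ := volume_dilate_ne_top _ _ _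
    have h4 : 2⁻¹ * V ≠ ∞ := ENNReal.mul_ne_top (by simp) hVt
    have h5 : ENNReal.ofReal (1 / (2 * 3 ^ d)) * volume Q = 2⁻¹ * V := by
      have h6 : ENNReal.ofReal (1 / (2 * 3 ^ d)) = 2⁻¹ * (3 ^ d)⁻¹ := by
        rw [one_div, ENNReal.ofReal_inv_of_pos (by positivity), ENNReal.ofReal_mul (by norm_num),
          ENNReal.ofReal_pow (by norm_num), ENNReal.mul_inv (by simp) (by simp)]
        norm_num
      rw [h6, h2]
      norm_num
      rw [mul_assoc, ← mul_assoc (3 ^ d)⁻¹, ENNReal.inv_mul_cancel (by positivity) (by simp),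
        one_mul]
    rw [h5]
    refine (ENNReal.add_le_add_iff_left h4).1 ?_
    rw [← add_mul, ENNReal.inv_two_add_inv_two, one_mul]
    calc V = _ := h3.symm
      _ ≤ _ := by gcongr
  · intro Q hQS Q' hQS' hne
    refine Set.disjoint_left.2 fun y ⟨hy, hyk⟩ ⟨hy', hyk'⟩ => hne ?_
    rw [← idx_eq_iff] at hy hy'
    have hs := (hsel Q hQS).congr hy
    have hs' := (hsel Q' hQS').congr hy'
    -- Stopping at level `k'` puts `y` in every superlevel set of height at most `A^k'`, so two
    -- chosen levels sharing `y` coincide; maximality then forces equal generations.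
    have hkle {k k' n : ℤ} (h : IsStopping g A n y k') (hk : y ∉ superlevel g (A ^ (k + 1))) :
        k' ≤ k := by
      by_contra hlt
      exact hk ⟨n, (ENNReal.zpow_le_of_le hA1 (by omega)).trans_lt h.1⟩
    have hkk : k Q = k Q' := le_antisymm (hkle hs hyk') (hkle hs' hyk)
    have hnn : n Q = n Q' := by
      rw [← hkk] at hs'
      rcases lt_trichotomy (n Q) (n Q') with hlt | heq | hlt
      · exact absurd hs'.1 (hs.2 _ hlt).not_gt
      · exact heq
      · exact absurd hs.1 (hs'.2 _ hlt).not_gt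
    rw [hQ Q hQS, hQ Q' hQS', ← hy, ← hy', hnn]

lemma IsSparse.mono {η η' : ℝ} (h : η' ≤ η) {S : Set (Set (EuclideanSpace ℝ (Fin d)))}
    (hS : IsSparse η S) : IsSparse η' S := by
  obtain ⟨hm, G, hG, hdisj⟩ := hS
  refine ⟨hm, G, fun Q hQ => ⟨(hG Q hQ).1, (hG Q hQ).2.1, le_trans ?_ (hG Q hQ).2.2⟩, hdisj⟩
  gcongr

/-! ### Geometric summation and the sparse operator. -/

/-- The constant arising from summing over the dyadic cubes below a stopping cube. -/
def geomConst (α : ℝ) : ℝ≥0∞ := ∑' j : ℕ, (ENNReal.ofReal (2 ^ (-α))) ^ j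

lemma geomConst_ne_top {α : ℝ} (hα : 0 < α) : geomConst α ≠ ∞ := by
  have h : ENNReal.ofReal (2 ^ (-α)) < 1 := by
    rw [ENNReal.ofReal_lt_one]
    exact Real.rpow_lt_one_of_one_lt_of_neg one_lt_two (neg_lt_zero.2 hα)
  rw [geomConst, ENNReal.tsum_geometric]
  exact ENNReal.inv_ne_top.2 (tsub_pos_of_lt h).ne'

lemma tsum_rpow_le (α : ℝ) (N : ℤ) :
    ∑' n : ℤ, (if n ≤ N then ENNReal.ofReal (((2 : ℝ) ^ n) ^ α) else 0) =
      ENNReal.ofReal (((2 : ℝ) ^ N) ^ α) * geomConst α := by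
  rw [geomConst, ← ENNReal.tsum_mul_left]
  have hinj : Function.Injective fun j : ℕ => N - (j : ℤ) := fun a b h => by
    simp only at h; omega
  rw [← hinj.tsum_eq (f := fun n : ℤ => if n ≤ N then ENNReal.ofReal (((2 : ℝ) ^ n) ^ α) else 0)]
  · refine tsum_congr fun j => ?_
    rw [if_pos (by omega), ← ENNReal.ofReal_pow (by positivity),
      ← ENNReal.ofReal_mul (by positivity)]
    congr 1
    rw [zpow_sub₀ two_ne_zero, Real.div_rpow (by positivity) (by positivity), div_eq_mul_inv,
      zpow_natCast, Real.rpow_neg (by norm_num), inv_pow, ← Real.rpow_natCast, ← Real.rpow_natCast,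
      ← Real.rpow_mul (by norm_num), ← Real.rpow_mul (by norm_num), mul_comm α]
  · intro n hn
    have : n ≤ N := by by_contra h; simp [h] at hn
    exact ⟨(N - n).toNat, by simp only; omega⟩

lemma tsum_avg_le (hd : d ≠ 0) (hg : ∫⁻ y, g y ≠ ∞) (hA : 1 < A) (hA' : A ≠ ∞) (α : ℝ)
    (x : EuclideanSpace ℝ (Fin d)) :
    ∑' n : ℤ, ENNReal.ofReal (((2 : ℝ) ^ n) ^ α) * avg g n (idx n x) ≤
      A * geomConst α * ∑' N : {N : ℤ // ∃ k, IsStopping g A N x k},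
        ENNReal.ofReal (((2 : ℝ) ^ (N : ℤ)) ^ α) * avg g N (idx N x) := by
  calc ∑' n : ℤ, ENNReal.ofReal (((2 : ℝ) ^ n) ^ α) * avg g n (idx n x)
      ≤ ∑' n : ℤ, ∑' N : {N : ℤ // ∃ k, IsStopping g A N x k},
        (if n ≤ (N : ℤ) then ENNReal.ofReal (((2 : ℝ) ^ n) ^ α) else 0) *
          (A * avg g N (idx N x)) := by
        refine ENNReal.tsum_le_tsum fun n => ?_
        by_cases h0 : avg g n (idx n x) = 0
        · simp [h0]
        obtain ⟨N, k, hnN, hs, hle⟩ := exists_isStopping hd hg hA hA' n x h0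
        refine le_trans ?_ (ENNReal.le_tsum ⟨N, k, hs⟩)
        rw [if_pos hnN]
        gcongr
    _ = ∑' N : {N : ℤ // ∃ k, IsStopping g A N x k},
        A * geomConst α * (ENNReal.ofReal (((2 : ℝ) ^ (N : ℤ)) ^ α) * avg g N (idx N x)) := by
        rw [ENNReal.tsum_comm]
        refine tsum_congr fun N => ?_
        rw [ENNReal.tsum_mul_right, tsum_rpow_le]
        ring
    _ = _ := ENNReal.tsum_mul_left

/-- The sparse operator sums over a set of cubes, so distinct generations must give distinct
members. -/
lemma dilate_one_injective_left (hd : d ≠ 0) {n N : ℤ} {m m' : Fin d → ℤ}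
    (h : dilate 1 n m = dilate 1 N m') : n = N := by
  have h1 := congrArg volume h
  rw [volume_dilate, volume_dilate] at h1
  have h2 := (ENNReal.pow_right_strictMono hd).injective h1
  rw [ENNReal.ofReal_eq_ofReal_iff (by positivity) (by positivity)] at h2
  exact zpow_right_injective₀ two_pos (by norm_num) (mul_left_cancel₀ (by norm_num) h2)

lemma tsum_stopping_le_sparseOperator (hd : d ≠ 0) {α : ℝ} (hα : 0 < α)
    (f : EuclideanSpace ℝ (Fin d) → ℂ) (x : EuclideanSpace ℝ (Fin d)) :
    ∑' N : {N : ℤ // ∃ k, IsStopping (fun y => ‖f y‖ₑ) A N x k},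
        ENNReal.ofReal (((2 : ℝ) ^ (N : ℤ)) ^ α) * avg (fun y => ‖f y‖ₑ) N (idx N x) ≤
      sparseOperator α (stoppingFamily (fun y => ‖f y‖ₑ) A) f x := by
  let φ : {N : ℤ // ∃ k, IsStopping (fun y => ‖f y‖ₑ) A N x k} →
      stoppingFamily (fun y => ‖f y‖ₑ) A :=
    fun N => ⟨dilate 1 N (idx N x), N, x, N.2.choose, N.2.choose_spec, rfl⟩
  have hφ : Function.Injective φ := fun N N' h =>
    Subtype.ext (dilate_one_injective_left hd (congrArg Subtype.val h))
  refine le_trans (ENNReal.tsum_le_tsum fun N => ?_) (ENNReal.tsum_comp_le_tsum_of_injective hφ _)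
  have hx : x ∈ dilate 1 (N : ℤ) (idx N x) := dilate_mono zero_le_one _ _ (mem_dilate_idx _ _)
  simp only [φ, Set.indicator_of_mem hx]
  rw [avg]
  gcongr
  have hd' : (0 : ℝ) < d := by positivity
  rw [volume_dilate, ← ENNReal.rpow_natCast, ← ENNReal.rpow_mul, mul_div_cancel₀ _ hd'.ne',
    ENNReal.ofReal_rpow_of_pos (by positivity)]
  -- The triple has side `3 * 2^N ≥ 2^N`.
  refine ENNReal.ofReal_le_ofReal (Real.rpow_le_rpow (by positivity) ?_ hα.le)
  exact le_mul_of_one_le_left (by positivity) (by norm_num)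

/-! ### The Riesz potential. -/

lemma enorm_rieszIntegrand_le {α : ℝ} (hαd : α < d) (f : EuclideanSpace ℝ (Fin d) → ℂ)
    (x y : EuclideanSpace ℝ (Fin d)) :
    ‖rieszIntegrand α f x y‖ₑ ≤ ∑' n : ℤ, ENNReal.ofReal (((2 : ℝ) ^ (n - 1)) ^ (α - d)) *
      (dilate 1 n (idx n x)).indicator (fun z => ‖f z‖ₑ) (x - y) := by
  have hs : 0 < (d : ℝ) - α := sub_pos.2 hαd
  rcases eq_or_ne y 0 with rfl | hy
  -- At the origin the kernel is `1 / 0 = 0`.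
  · simp [rieszIntegrand, Real.zero_rpow hs.ne']
  have hy' : 0 < ‖y‖ := norm_pos_iff.2 hy
  obtain ⟨n, hn, hn'⟩ := exists_mem_Ioc_zpow hy' (one_lt_two (α := ℝ))
  -- With `2^n < ‖y‖ ≤ 2^(n+1)`, the single term `n + 1` suffices.
  refine le_trans ?_ (ENNReal.le_tsum (n + 1))
  have h2 : (0 : ℝ) < 2 ^ (n + 1) := by positivity
  have hmem : x - y ∈ dilate 1 (n + 1) (idx (n + 1) x) := by
    have hx := mem_dilate_idx (n + 1) x
    rw [mem_dilate] at hx ⊢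
    intro i
    obtain ⟨h3, h4⟩ := hx i
    have h5 : |y i| ≤ 2 ^ (n + 1) := (Real.norm_eq_abs _ ▸ PiLp.norm_apply_le y i).trans hn'
    obtain ⟨h6, h7⟩ := abs_le.1 h5
    rw [PiLp.sub_apply]
    constructor <;> linarith
  rw [Set.indicator_of_mem hmem, rieszIntegrand, enorm_smul, add_sub_cancel_right]
  gcongr
  rw [Real.enorm_of_nonneg (by positivity)]
  refine ENNReal.ofReal_le_ofReal ?_
  rw [one_div, ← Real.rpow_neg hy'.le, neg_sub]
  exact Real.rpow_le_rpow_of_nonpos (by positivity) hn.le (by linarith)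

/-- The Riesz potential of `|f|` is controlled by averages over dyadic cubes around the point. -/
lemma lintegral_rieszIntegrand_le {α : ℝ} (hαd : α < d) {f : EuclideanSpace ℝ (Fin d) → ℂ}
    (hf : AEStronglyMeasurable f) (x : EuclideanSpace ℝ (Fin d)) :
    ∫⁻ y, ‖rieszIntegrand α f x y‖ₑ ≤ ENNReal.ofReal (2 ^ (d - α) * 3 ^ d) *
      ∑' n : ℤ, ENNReal.ofReal (((2 : ℝ) ^ n) ^ α) * avg (fun y => ‖f y‖ₑ) n (idx n x) := by
  calc ∫⁻ y, ‖rieszIntegrand α f x y‖ₑ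
      ≤ ∫⁻ y, ∑' n : ℤ, ENNReal.ofReal (((2 : ℝ) ^ (n - 1)) ^ (α - d)) *
        (dilate 1 n (idx n x)).indicator (fun z => ‖f z‖ₑ) (x - y) :=
        lintegral_mono fun y => enorm_rieszIntegrand_le hαd f x y
    _ = ∫⁻ y, ∑' n : ℤ, ENNReal.ofReal (((2 : ℝ) ^ (n - 1)) ^ (α - d)) *
        (dilate 1 n (idx n x)).indicator (fun z => ‖f z‖ₑ) y :=
        lintegral_sub_left_eq_self (μ := volume) (fun z => ∑' n : ℤ,
          ENNReal.ofReal (((2 : ℝ) ^ (n - 1)) ^ (α - d)) *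
            (dilate 1 n (idx n x)).indicator (fun z => ‖f z‖ₑ) z) x
    _ = ∑' n : ℤ, ENNReal.ofReal (((2 : ℝ) ^ (n - 1)) ^ (α - d)) *
        ∫⁻ y in dilate 1 n (idx n x), ‖f y‖ₑ := by
        rw [lintegral_tsum fun n =>
          (hf.enorm.indicator (measurableSet_dilate 1 n (idx n x))).const_mul _]
        refine tsum_congr fun n => ?_
        rw [lintegral_const_mul' _ _ ENNReal.ofReal_ne_top,
          lintegral_indicator (measurableSet_dilate _ _ _)]
    _ = _ := by
        rw [← ENNReal.tsum_mul_left]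
        refine tsum_congr fun n => ?_
        rw [lintegral_eq_avg, volume_dilate, ← ENNReal.ofReal_pow (by positivity), ← mul_assoc,
          ← mul_assoc, ← ENNReal.ofReal_mul (by positivity), ← ENNReal.ofReal_mul (by positivity)]
        congr 2
        have h2 : (0 : ℝ) < 2 ^ n := by positivity
        rw [zpow_sub_one₀ two_ne_zero, Real.mul_rpow h2.le (by norm_num),
          Real.rpow_sub h2, Real.rpow_natCast, Real.inv_rpow (by norm_num),
          ← Real.rpow_neg (by norm_num), neg_sub, mul_pow]
        norm_num
        field_simp

lemma integrableOn_ball_norm_rpow [NeZero d] {α : ℝ} (hα0 : 0 < α) :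
    IntegrableOn (fun y : EuclideanSpace ℝ (Fin d) => 1 / ‖y‖ ^ ((d : ℝ) - α))
      (Metric.ball 0 1) := by
  rw [integrableOn_fun_norm_addHaar volume (f := fun r : ℝ => 1 / r ^ ((d : ℝ) - α)),
    finrank_euclideanSpace_fin]
  refine ((intervalIntegral.integrableOn_Ioo_rpow_iff (s := α - 1) one_pos).2
    (by linarith)).congr_fun (fun y hy => ?_) measurableSet_Ioo
  have hy0 : 0 < y := hy.1
  have hd : 1 ≤ d := NeZero.one_le
  rw [smul_eq_mul, ← Real.rpow_natCast, Nat.cast_sub hd, one_div, ← Real.rpow_neg hy0.le,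
    ← Real.rpow_add hy0]
  dsimp only
  congr 1
  push_cast
  ring

/-- Inside the unit ball the kernel is integrable, so its convolution with `f` exists a.e.; outside
it is bounded by `1`. -/
lemma ae_integrable_rieszIntegrand {α : ℝ} (hα0 : 0 < α) (hαd : α < d)
    {f : EuclideanSpace ℝ (Fin d) → ℂ} (hf : Integrable f) :
    ∀ᵐ x, Integrable (rieszIntegrand α f x) := by
  have hd : (0 : ℝ) < d := hα0.trans hαd
  have : NeZero d := ⟨by rintro rfl; simp at hd⟩
  let κ : EuclideanSpace ℝ (Fin d) → ℝ := fun y => 1 / ‖y‖ ^ ((d : ℝ) - α)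
  have hκ : Measurable κ := by fun_prop
  have h1 : Integrable ((Metric.ball 0 1).indicator κ) :=
    (integrable_indicator_iff measurableSet_ball).2 (integrableOn_ball_norm_rpow hα0)
  filter_upwards [h1.ae_convolution_exists (ContinuousLinearMap.lsmul ℝ ℝ) hf] with x hx
  have h2 : Integrable fun y => (Metric.ball 0 1)ᶜ.indicator κ y • f (x - y) := by
    refine (hf.comp_sub_left x).bdd_smul (φ := (Metric.ball 0 1)ᶜ.indicator κ) 1 ?_ ?_
    · exact (hκ.indicator measurableSet_ball.compl).aestronglyMeasurable
    · refine .of_forall fun y => ?_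
      by_cases hy : y ∈ Metric.ball (0 : EuclideanSpace ℝ (Fin d)) 1
      · simp [hy]
      · rw [Set.indicator_of_mem (by exact hy), Real.norm_of_nonneg (by positivity)]
        have hy1 : 1 ≤ ‖y‖ := by simpa using hy
        exact div_le_one_of_le₀ (Real.one_le_rpow hy1 (sub_nonneg.2 hαd.le)) (by positivity)
  refine (hx.integrable.add h2).congr (.of_forall fun y => ?_)
  simp only [Pi.add_apply, ContinuousLinearMap.lsmul_apply, ← add_smul]
  rw [Set.indicator_self_add_compl_apply]
  rfl

end SparseRiesz

end

theorem proposition3p2 (d : ℕ) (α : ℝ) (hα0 : 0 < α) (hαd : α < d) :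
    ∃ C : ℝ≥0, ∀ f : EuclideanSpace ℝ (Fin d) → ℂ,
      Integrable f volume → SparseRiesz.HasCompactEssSupport f →
      (∀ᵐ x, Integrable (SparseRiesz.rieszIntegrand α f x) volume) ∧
      ∃ S : Set (Set (EuclideanSpace ℝ (Fin d))),
        (∀ Q ∈ S, SparseRiesz.IsCube Q) ∧
        SparseRiesz.IsSparse (1 / (2 * (4 * √(d : ℝ) + 2) ^ d)) S ∧
        ∀ᵐ x, ‖SparseRiesz.rieszPotential α f x‖ₑ ≤ C * SparseRiesz.sparseOperator α S f x := by
  have hd0 : (0 : ℝ) < d := hα0.trans hαd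
  have hd : d ≠ 0 := by rintro rfl; simp at hd0
  let A : ℝ≥0∞ := 2 * 30 ^ d
  have hA' : A ≠ ∞ := by simp [A, ENNReal.mul_eq_top]
  have hA : 1 < A := by
    calc (1 : ℝ≥0∞) < 2 := by norm_num
      _ ≤ A := le_mul_of_one_le_right' (one_le_pow₀ (by norm_num))
  let C : ℝ≥0∞ := ENNReal.ofReal (2 ^ (d - α) * 3 ^ d) * (A * SparseRiesz.geomConst α)
  have hC : C ≠ ∞ := ENNReal.mul_ne_top ENNReal.ofReal_ne_top
    (ENNReal.mul_ne_top hA' (SparseRiesz.geomConst_ne_top hα0))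
  refine ⟨C.toNNReal, fun f hf _ => ⟨SparseRiesz.ae_integrable_rieszIntegrand hα0 hαd hf,
    SparseRiesz.stoppingFamily (fun y => ‖f y‖ₑ) A,
    fun Q => SparseRiesz.isCube_of_mem_stoppingFamily,
    (SparseRiesz.isSparse_stoppingFamily le_rfl hA').mono ?_, .of_forall fun x => ?_⟩⟩
  -- Here `3 ≤ 4√d + 2`, so the sparseness `1 / (2 * 3^d)` is more than enough.
  · have h1 : 1 ≤ √(d : ℝ) := Real.one_le_sqrt.2 (by exact_mod_cast Nat.one_le_iff_ne_zero.2 hd)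
    gcongr
    linarith
  · rw [ENNReal.coe_toNNReal hC]
    -- This holds at every `x`: a divergent Bochner integral is `0` by convention.
    calc ‖SparseRiesz.rieszPotential α f x‖ₑ
        ≤ ∫⁻ y, ‖SparseRiesz.rieszIntegrand α f x y‖ₑ := enorm_integral_le_lintegral_enorm _
      _ ≤ _ := SparseRiesz.lintegral_rieszIntegrand_le hαd hf.aestronglyMeasurable x
      _ ≤ _ := by
        simp only [C]
        rw [mul_assoc]
        gcongr
        refine (SparseRiesz.tsum_avg_le hd hf.hasFiniteIntegral.ne hA hA' α x).trans ?_
        gcongr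
        exact SparseRiesz.tsum_stopping_le_sparseOperator hd hα0 f x
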